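/- Let $K$ be an algebraically closed field and let $F$ be a function field of one variable over $K$ of genus $0$. For a divisor $D=\sum_P n_P P$ of $F/K$ (all places have degree one) put $\deg D=\sum_P n_P$ and $L(D)=\{f\in F : v_P(f)\ge -n_P \text{ for all places } P\}$. For a finite-dimensional $K$-subspace $T\subset F$ let $T^2$ be the $K$-span of the products of two elements of $T$; the combinatorial genus of $T$ is $\dim T^2-2\dim T+1$. Let $S\subset F$ be a $K$-subspace of finite dimension $n$ with $K\subset S$ and $F=K(S)$, whose combinatorial genus $\gamma$ satisfies $\gamma\le n-3$. Fix a place of $F/K$ with normalized valuation $v$, and let $S_1\subset S_2\subset\dots\subset S_n=S$ be the natural filtration of $S$ with respect to $v$: $S_i=\langle e_1,\dots,e_i\rangle$, where $(e_1,\dots,e_n)$ is a basis of $S$ with $v(e_1)>v(e_2)>\dots>v(e_n)$. For $1\le i\le n$ let $\gamma_i$ be the combinatorial genus of $S_i$ and let $D_i$ be the divisor of least degree such that $S_i\subset L(D_i)$. Put $$\Delta_{\mathrm{Max}}=\max_{2\le i\le n}\bigl(\deg D_i-\deg D_{i-1}\bigr).$$ Suppose that $\gamma_3=0$, that $\Delta_{\mathrm{Max}}\le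 n$ (so that $\gamma_{\Delta_{\mathrm{Max}}}$ is defined) and that $\gamma_{\Delta_{\mathrm{Max}}}=0$. Then, for $D=D_n$, the space $L(D)$ contains $S$ and satisfies $\dim L(D)\le n+\gamma$. -/

import Mathlib

open Module

noncomputable section

namespace FreimanFF

variable (K F : Type*) [Field K] [Field F] [Algebra K F]

/-- `F` is an (algebraic) function field of one variable over `K`: a finite extension of `K(x)`
for some `x` that is transcendental over `K`. -/
def IsFunctionField : Prop :=
  ∃ x : F, Transcendental K x ∧ FiniteDimensional (IntermediateField.adjoin K {x}) F

/-- A place of `F / K`, given by its normalized discrete valuation `F → ℤ ∪ {∞}`, which is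
trivial on `K`. Two places are equal iff their valuations are. -/
structure Place where
  /-- the normalized valuation of the place -/
  v : AddValuation F (WithTop ℤ)
  /-- it is trivial on the constants -/
  trivial_on : ∀ c : K, c ≠ 0 → v (algebraMap K F c) = 0
  /-- it is normalized: there is a uniformizer -/
  exists_uniformizer : ∃ π : F, v π = 1

/-- Divisors of `F / K`: the free abelian group on the places. -/
abbrev Divisor : Type _ := Place K F →₀ ℤ

variable {K F}

/-- The degree of a divisor. Over an algebraically closed field `K` every place of a function
field has residue field `K`, i.e. degree one, so that this is the sum of the coefficients. -/
def Divisor.degree (D : Divisor K F) : ℤ := D.sum fun _ m => m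

/-- The Riemann-Roch space `L(D) = {f | v_P(f) ≥ -D(P) for all places P}` (it contains `0`, as
`v_P(0) = ∞`). -/
def riemannRoch (D : Divisor K F) : Submodule K F where
  carrier := {f | ∀ P : Place K F, ((-D P : ℤ) : WithTop ℤ) ≤ P.v f}
  zero_mem' := fun P => by rw [P.v.map_zero]; exact le_top
  add_mem' := fun {f g} hf hg P => P.v.map_le_add (hf P) (hg P)
  smul_mem' := fun c f hf P => by
    by_cases hc : c = 0
    · rw [hc, zero_smul, P.v.map_zero]; exact le_top
    · rw [Algebra.smul_def, P.v.map_mul, P.trivial_on c hc, zero_add]; exact hf P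

variable (K F) in
/-- `F / K` has genus `g`: `g` is the maximum of `deg A + 1 - dim L(A)` over all divisors `A`. -/
def HasGenus (g : ℕ) : Prop :=
  IsGreatest
    (Set.range fun A : Divisor K F => A.degree + 1 - (finrank K (riemannRoch A) : ℤ)) (g : ℤ)

/-- `D` is a divisor of least degree such that `T ⊆ L(D)`. -/
def IsLeastDegreeDivisor (T : Submodule K F) (D : Divisor K F) : Prop :=
  T ≤ riemannRoch D ∧ ∀ D' : Divisor K F, T ≤ riemannRoch D' → D.degree ≤ D'.degree

/-- The combinatorial genus `dim T² - 2 dim T + 1`; here `T * T` is the `K`-span of the products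
of two elements of `T`. -/
def combGenus (T : Submodule K F) : ℤ :=
  (finrank K (T * T : Submodule K F) : ℤ) - 2 * (finrank K T : ℤ) + 1

/-- `(e 0, …, e (n-1))` is a `K`-basis of `S` with strictly decreasing valuations at `P`. -/
structure IsFilteredBasis (P : Place K F) (S : Submodule K F) {n : ℕ} (e : Fin n → F) : Prop where
  linearIndependent : LinearIndependent K e
  span_eq : Submodule.span K (Set.range e) = S
  strictAnti : StrictAnti fun i => P.v (e i)

/-- The `i`-th member `S_i` of the filtration that belongs to `e`: the span of the first `i`
vectors (for `1 ≤ i ≤ n`). -/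
def filtration {n : ℕ} (e : Fin n → F) (i : ℕ) : Submodule K F :=
  Submodule.span K (e '' {j | (j : ℕ) < i})

end FreimanFF

end

/-!
The theorem is the bound `dim S² ≥ min (3n - 3, n + dim L(D) - 1)` for `D = D_n`: since `γ ≤ n - 3`
means `dim S² ≤ 3n - 4`, the second alternative holds, and it says `dim L(D) ≤ n + γ`. The bound is
Castelnuovo's, and the proof is a version of his general hyperplane section argument in which
general position is replaced by linear additive combinatorics.

Choose `y ∈ S` nonconstant and a general `g ∈ S`, so that `g` has all the poles that `D` allows and
`F = K(g, y)`. Let `λ` be a variable, `E = F(λ)` and `k = K(λ, g + λ y)`; the extension `E / k` is the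
function field of the section of the curve by a general member `τ - g - λ y` of the net spanned by
`1`, `g` and `y`.

* The only relation over `k` between independent elements of `L(D)` comes from the equation of the
  section, because a quotient by `τ - g - λ y` has constant coefficients. Hence
  `dim_k kV ≥ dim_K V - 1` both for `V = S` and for `V = L(D)`
  (`finrank_le_finrank_constSpan_add_one`).
* Multiplying the equation of the section by the elements of `S` gives `n` independent relations
  between elements of `S²`, so that `dim_K S² ≥ n + dim_k kS²`
  (`finrank_add_finrank_constSpan_le`).
* There is no proper intermediate field of `E / k` (`eq_bot_or_eq_top_of_specialize`). Here genus `0`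
  is used in the form `F = K(x)` (`exists_rational_generator`): the minimal polynomial of `x` over `k`
  factors over `E` as `T - x` times a polynomial that is irreducible or constant. In the separable
  case this says that the section has a doubly transitive monodromy group.
* In an extension without proper intermediate fields the linear Cauchy-Davenport theorem holds
  (`mul_eq_top_or_finrank_add_le`): either `kS² = E`, or
  `dim_k kS² ≥ 2 dim_k kS - 1 ≥ 2 (n - 1) - 1`.

In the second case `dim_K S² ≥ 3n - 3`. In the first one
`dim_K S² ≥ n + [E : k] ≥ n + dim L(D) - 1`.
-/

namespace FreimanFF

/-! ### Linear Cauchy-Davenport theorem -/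

theorem finrank_map_mulLeft {k E : Type*} [Field k] [Field E] [Algebra k E] {a : E} (ha : a ≠ 0)
    (B : Submodule k E) : finrank k (B.map (LinearMap.mulLeft k a)) = finrank k B :=
  (Submodule.equivMapOfInjective _ (mul_right_injective₀ ha) B).finrank_eq.symm

theorem finiteDimensional_mul {k E : Type*} [Field k] [Field E] [Algebra k E]
    (A B : Submodule k E) [FiniteDimensional k A] [FiniteDimensional k B] :
    FiniteDimensional k (A * B : Submodule k E) :=
  Module.Finite.iff_fg.2 ((Module.Finite.iff_fg.1 ‹_›).mul (Module.Finite.iff_fg.1 ‹_›))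

/-- Linear Cauchy-Davenport theorem: in an algebraic extension without proper intermediate fields,
`dim AB ≥ dim A + dim B - 1` unless `AB` is the whole field. If some quotient `e = a / b` satisfies
`A ⊄ eB`, then the Dyson transform `(A ∩ eB, B + e⁻¹A)` lowers `dim A`, keeps the sum of the
dimensions and does not enlarge the product. Otherwise `B` is a module over the field generated
by the quotients of elements of `A`. -/
theorem mul_eq_top_or_finrank_add_le {k E : Type*} [Field k] [Field E] [Algebra k E]
    [Algebra.IsAlgebraic k E] (hprim : ∀ M : IntermediateField k E, M = ⊥ ∨ M = ⊤)
    (A B : Submodule k E) [FiniteDimensional k A] [FiniteDimensional k B]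
    (hA : A ≠ ⊥) (hB : B ≠ ⊥) :
    A * B = ⊤ ∨ finrank k A + finrank k B ≤ finrank k (A * B : Submodule k E) + 1 := by
  induction hN : finrank k A using Nat.strong_induction_on generalizing A B with
  | _ N ih =>
  subst hN
  have := finiteDimensional_mul A B
  by_cases hcase : ∃ a ∈ A, ∃ b ∈ B, a ≠ 0 ∧ b ≠ 0 ∧
      ¬ A ≤ B.map (LinearMap.mulLeft k (a / b))
  · obtain ⟨a, haA, b, hbB, ha, hb, hnle⟩ := hcase
    set e := a / b with he
    have he0 : e ≠ 0 := div_ne_zero ha hb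
    set A' := A ⊓ B.map (LinearMap.mulLeft k e) with hA'
    set B' := B ⊔ A.map (LinearMap.mulLeft k e⁻¹) with hB'
    have haA' : a ∈ A' := ⟨haA, b, hbB, by simp [he, div_mul_cancel₀ _ hb]⟩
    have hA'0 : A' ≠ ⊥ := fun h => ha (by simpa [h] using haA')
    have hB'0 : B' ≠ ⊥ := fun h => hB (eq_bot_iff.2 (h ▸ le_sup_left))
    have hlt : finrank k A' < finrank k A :=
      Submodule.finrank_lt_finrank_of_lt (inf_le_left.lt_of_ne fun h => hnle (inf_eq_left.1 h))
    have heB' : B'.map (LinearMap.mulLeft k e) = A ⊔ B.map (LinearMap.mulLeft k e) := by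
      rw [hB', Submodule.map_sup, ← Submodule.map_comp, sup_comm]
      have : LinearMap.mulLeft k e ∘ₗ LinearMap.mulLeft k e⁻¹ = LinearMap.id := by
        ext z
        simp [he0]
      rw [this, Submodule.map_id]
    have hsum : finrank k A' + finrank k B' = finrank k A + finrank k B := by
      rw [← finrank_map_mulLeft he0 B', heB', ← finrank_map_mulLeft he0 B, add_comm (finrank k A')]
      exact Submodule.finrank_sup_add_finrank_inf_eq _ _
    have hle : A' * B' ≤ A * B := by
      rw [Submodule.mul_le]
      rintro z ⟨hzA, w, hwB, rfl⟩ c hc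
      obtain ⟨c₁, hc₁, _, ⟨c₂, hc₂, rfl⟩, rfl⟩ := Submodule.mem_sup.1 hc
      rw [mul_add]
      refine add_mem (Submodule.mul_mem_mul hzA hc₁) ?_
      have : LinearMap.mulLeft k e w * LinearMap.mulLeft k e⁻¹ c₂ = c₂ * w := by
        simp only [LinearMap.mulLeft_apply]
        field_simp
      rw [this]
      exact Submodule.mul_mem_mul hc₂ hwB
    rcases ih _ hlt A' B' hA'0 hB'0 rfl with h | h
    · exact Or.inl (top_le_iff.1 (h ▸ hle))
    · right
      have := Submodule.finrank_mono hle
      omega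
  · push Not at hcase
    let M₀ : Subalgebra k E :=
      { carrier := {z | ∀ b ∈ B, z * b ∈ B}
        mul_mem' := fun {z w} hz hw b hb => by rw [mul_assoc]; exact hz _ (hw _ hb)
        add_mem' := fun {z w} hz hw b hb => by rw [add_mul]; exact add_mem (hz _ hb) (hw _ hb)
        algebraMap_mem' := fun c b hb => by
          rw [← Algebra.smul_def]; exact B.smul_mem c hb }
    let M : IntermediateField k E := M₀.toIntermediateField fun z hz => by
      have := M₀.inv_mem_of_algebraic (x := ⟨z, hz⟩) (Algebra.IsAlgebraic.isAlgebraic z)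
      exact this
    obtain ⟨a, haA, ha⟩ := A.ne_bot_iff.1 hA
    obtain ⟨b, hbB, hb⟩ := B.ne_bot_iff.1 hB
    have hquot : ∀ z ∈ A, z / a ∈ M := by
      intro z hz c hc
      by_cases hc0 : c = 0
      · simp [hc0]
      obtain ⟨d, hd, hdz⟩ := hcase a haA c hc ha hc0 hz
      simp only [LinearMap.mulLeft_apply] at hdz
      have : z / a * c = d := by rw [← hdz]; field_simp
      rwa [this]
    rcases hprim M with hM | hM
    · right
      have h1 : finrank k A ≤ 1 := by
        refine finrank_le_one (⟨a, haA⟩ : A) fun z => ?_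
        have := hquot z z.2
        rw [hM, IntermediateField.mem_bot] at this
        obtain ⟨c, hc⟩ := this
        refine ⟨c, Subtype.ext ?_⟩
        simp only [SetLike.val_smul, Algebra.smul_def, hc]
        field_simp
      have h2 : finrank k B ≤ finrank k (A * B : Submodule k E) := by
        rw [← finrank_map_mulLeft ha B]
        refine Submodule.finrank_mono ?_
        rintro _ ⟨c, hc, rfl⟩
        exact Submodule.mul_mem_mul haA hc
      omega
    · left
      rw [eq_top_iff]
      intro z _
      have : z / a / b ∈ M := hM ▸ IntermediateField.mem_top
      have h3 : a * (z / a / b * b) = z := by field_simp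
      rw [← h3]
      exact Submodule.mul_mem_mul haA (this b hbB)

/-! ### Constants and residue fields -/

open Polynomial

variable {K F : Type*} [Field K] [Field F] [Algebra K F]

theorem exists_algebraMap_eq_of_isAlgebraic [IsAlgClosed K] {f : F} (hf : IsAlgebraic K f) :
    ∃ c : K, algebraMap K F c = f :=
  minpoly.mem_range_of_degree_eq_one K f
    (IsAlgClosed.degree_eq_one_of_irreducible K (minpoly.irreducible hf.isIntegral))

theorem Place.zero_le_v_algebraMap (P : Place K F) (c : K) : 0 ≤ P.v (algebraMap K F c) := by
  by_cases hc : c = 0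
  · simp [hc]
  · rw [P.trivial_on c hc]

theorem Place.zero_le_v_pow (P : Place K F) {t : F} (ht : 0 ≤ P.v t) (n : ℕ) :
    0 ≤ P.v (t ^ n) := by
  rw [AddValuation.map_pow]
  exact nsmul_nonneg ht n

theorem Place.zero_le_v_aeval (P : Place K F) {t : F} (ht : 0 ≤ P.v t) (a : K[X]) :
    0 ≤ P.v (aeval t a) := by
  rw [aeval_eq_sum_range]
  refine P.v.map_le_sum fun i _ => ?_
  rw [Algebra.smul_def, AddValuation.map_mul]
  exact add_nonneg (P.zero_le_v_algebraMap _) (P.zero_le_v_pow ht i)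

/-- The elements without poles form a subalgebra of finite dimension, so they are constant. -/
theorem exists_algebraMap_eq_of_mem_riemannRoch_zero [IsAlgClosed K] (hg : HasGenus K F 0)
    {f : F} (hf : f ∈ riemannRoch (0 : Divisor K F)) : ∃ c : K, algebraMap K F c = f := by
  let A : Subalgebra K F :=
    { carrier := {f | ∀ P : Place K F, 0 ≤ P.v f}
      mul_mem' := fun {a b} ha hb P => by
        rw [AddValuation.map_mul]; exact add_nonneg (ha P) (hb P)
      add_mem' := fun {a b} ha hb P => P.v.map_le_add (ha P) (hb P)
      algebraMap_mem' := fun c P => P.zero_le_v_algebraMap c }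
  have hA : Subalgebra.toSubmodule A = riemannRoch (0 : Divisor K F) := by
    ext z
    simp [A, riemannRoch]
  have h0 := hg.2 ⟨(0 : Divisor K F), rfl⟩
  have hfin : FiniteDimensional K (riemannRoch (0 : Divisor K F)) := by
    refine Module.finite_of_finrank_pos ?_
    simp only [Divisor.degree, Finsupp.sum_zero_index] at h0
    omega
  refine exists_algebraMap_eq_of_isAlgebraic (IsIntegral.isAlgebraic (.of_mem_of_fg A ?_ f ?_))
  · rw [hA]; exact Module.Finite.iff_fg.1 hfin
  · exact (SetLike.ext_iff.1 hA f).2 hf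

theorem IsFunctionField.isTranscendenceBasis (hF : IsFunctionField K F) {t : F}
    (ht : Transcendental K t) : IsTranscendenceBasis K fun _ : Unit => t := by
  obtain ⟨x, hx, hfin⟩ := hF
  have hx' : AlgebraicIndependent K fun _ : Unit => x := algebraicIndependent_unique_type_iff.2 hx
  have : Algebra.IsAlgebraic (IntermediateField.adjoin K {x}) F := inferInstance
  have halg : Algebra.IsAlgebraic (Algebra.adjoin K {x}) F := by
    open scoped IntermediateField.algebraAdjoinAdjoin in
    exact Algebra.IsAlgebraic.trans (Algebra.adjoin K {x}) (IntermediateField.adjoin K {x}) F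
  refine (algebraicIndependent_unique_type_iff.2 ht :
    AlgebraicIndependent K fun _ : Unit => t).isTranscendenceBasis_of_lift_trdeg_le_of_finite ?_
  have := Algebra.IsAlgebraic.trdeg_le_cardinalMk K ({x} : Set F)
  simpa using this

theorem IsFunctionField.isAlgebraic (hF : IsFunctionField K F) {t : F}
    (ht : Transcendental K t) : Algebra.IsAlgebraic (IntermediateField.adjoin K {t}) F := by
  have := (hF.isTranscendenceBasis ht).isAlgebraic_field
  rwa [Set.range_const] at this

/-- Every element of `F` satisfies an algebraic equation over `K[t]`. -/
theorem IsFunctionField.exists_relation (hF : IsFunctionField K F) {t : F}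
    (ht : Transcendental K t) (f : F) :
    ∃ r : K[X][X], r ≠ 0 ∧ r.eval₂ (aeval t : K[X] →ₐ[K] F).toRingHom f = 0 := by
  have h := (hF.isTranscendenceBasis ht).isAlgebraic
  rw [Set.range_const] at h
  let : Algebra K[X] F := (aeval t : K[X] →ₐ[K] F).toRingHom.toAlgebra
  let φ : K[X] →+* Algebra.adjoin K {t} :=
    (aeval (⟨t, Algebra.subset_adjoin rfl⟩ : Algebra.adjoin K {t}) : K[X] →ₐ[K] _).toRingHom
  have hφ : Function.Surjective φ := by
    rintro ⟨z, hz⟩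
    rw [Algebra.adjoin_singleton_eq_range_aeval] at hz
    obtain ⟨p, rfl⟩ := hz
    refine ⟨p, Subtype.ext ?_⟩
    exact (aeval_algHom_apply (Algebra.adjoin K {t}).val _ p).symm
  have := (h.isAlgebraic f).of_ringHom_of_comp_eq φ (RingHom.id F) hφ Function.injective_id (by
    refine RingHom.ext fun p => ?_
    exact (aeval_algHom_apply (Algebra.adjoin K {t}).val _ p).symm)
  exact this

/-- The residue field of a place is `K`: an element without a pole at `P` is congruent to a
constant. -/
theorem Place.exists_zero_lt_v_sub [IsAlgClosed K] (hF : IsFunctionField K F) (P : Place K F)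
    {t : F} (ht : Transcendental K t) (hPt : 0 < P.v t) {f : F} (hf : 0 ≤ P.v f) :
    ∃ c : K, 0 < P.v (f - algebraMap K F c) := by
  obtain ⟨r, hr0, hr⟩ := hF.exists_relation ht f
  have hinj : Function.Injective (aeval t : K[X] →ₐ[K] F) :=
    transcendental_iff_injective.1 ht
  obtain ⟨_⟩ : Nonempty (NormalizedGCDMonoid K[X]) := inferInstance
  -- dividing by the content makes the reduction of the relation at `P` nonzero
  set s := r.primPart with hs
  have hsf : s.eval₂ (aeval t : K[X] →ₐ[K] F).toRingHom f = 0 := by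
    rw [r.eq_C_content_mul_primPart, eval₂_mul, eval₂_C, mul_eq_zero] at hr
    refine hr.resolve_left fun h => hr0 ?_
    rw [← content_eq_zero_iff]
    exact hinj (by simpa using h)
  set h : K[X] := s.map (constantCoeff : K[X] →+* K) with hh
  have hh0 : h ≠ 0 := by
    intro h0
    have hX : (C X : K[X][X]) ∣ s := by
      rw [C_dvd_iff_dvd_coeff]
      intro i
      rw [X_dvd_iff]
      simpa [hh, constantCoeff_apply] using congrArg (fun p : K[X] => p.coeff i) h0
    exact not_isUnit_X (isPrimitive_iff_isUnit_of_C_dvd.1 r.isPrimitive_primPart X hX)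
  have hhf : 0 < P.v (aeval f h) := by
    have key : aeval f h = -(s.eval₂ (aeval t : K[X] →ₐ[K] F).toRingHom f - aeval f h) := by
      rw [hsf]; ring
    rw [key, AddValuation.map_neg, eval₂_eq_sum_range, aeval_eq_sum_range' (n := s.natDegree + 1)
      (Nat.lt_succ_of_le natDegree_map_le), ← Finset.sum_sub_distrib]
    refine P.v.map_lt_sum' (WithTop.coe_lt_top 0) fun i _ => ?_
    have hc : (aeval t : K[X] →ₐ[K] F).toRingHom (s.coeff i) * f ^ i - h.coeff i • f ^ i
        = t * aeval t (s.coeff i).divX * f ^ i := by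
      have h1 : aeval t (s.coeff i) =
          t * aeval t (s.coeff i).divX + algebraMap K F ((s.coeff i).coeff 0) := by
        have := congrArg (aeval t) (X_mul_divX_add (s.coeff i))
        rw [map_add, map_mul, aeval_X, aeval_C] at this
        exact this.symm
      rw [AlgHom.toRingHom_eq_coe, RingHom.coe_coe, h1, hh, coeff_map, constantCoeff_apply,
        Algebra.smul_def]
      ring
    rw [hc, AddValuation.map_mul, AddValuation.map_mul]
    exact add_pos_of_pos_of_nonneg
      (add_pos_of_pos_of_nonneg hPt (P.zero_le_v_aeval hPt.le _)) (P.zero_le_v_pow hf i)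
  clear_value h
  clear hh
  induction hn : h.natDegree generalizing h with
  | zero =>
    rw [eq_C_of_natDegree_eq_zero hn] at hh0 hhf
    rw [aeval_C, P.trivial_on _ (by simpa using hh0)] at hhf
    exact absurd hhf (lt_irrefl _)
  | succ n ih =>
    obtain ⟨c, hc⟩ := IsAlgClosed.exists_root h (by
      rw [degree_eq_natDegree hh0, hn]; exact_mod_cast n.succ_ne_zero)
    obtain ⟨h', rfl⟩ := dvd_iff_isRoot.2 hc
    have h'0 : h' ≠ 0 := right_ne_zero_of_mul hh0
    by_cases hp : 0 < P.v (f - algebraMap K F c)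
    · exact ⟨c, hp⟩
    · refine ih h' h'0 ?_ ?_
      · rw [map_mul, AddValuation.map_mul] at hhf
        by_contra hneg
        simp only [map_sub, aeval_X, aeval_C] at hhf
        exact absurd hhf (not_lt.2 (add_nonpos (not_lt.1 hp) (not_lt.1 hneg)))
      · rw [natDegree_mul (X_sub_C_ne_zero c) h'0, natDegree_X_sub_C] at hn
        omega

/-! ### Rationality of function fields of genus zero -/

theorem WithTop.int_one_le_of_pos {a : WithTop ℤ} (h : 0 < a) : 1 ≤ a := by
  cases a with
  | top => exact le_top
  | coe a => exact_mod_cast (show (0 : ℤ) < a by exact_mod_cast h)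

/-- An element that is integral over `K[x]` has poles only at the poles of `x`. -/
theorem Place.zero_le_v_of_isIntegral (P : Place K F) {x : F} (hx : 0 ≤ P.v x) {w : F}
    (hw : ∃ r : K[X][X], r.Monic ∧ r.eval₂ (aeval x : K[X] →ₐ[K] F).toRingHom w = 0) :
    0 ≤ P.v w := by
  obtain ⟨r, hr, hrw⟩ := hw
  let V : Valuation F (Multiplicative (WithTop ℤ)ᵒᵈ) := AddValuation.toValuation P.v
  have hV : ∀ z : F, V z ≤ 1 ↔ 0 ≤ P.v z := fun z => Iff.rfl
  let ψ : K[X] →+* V.integer := (aeval x : K[X] →ₐ[K] F).toRingHom.codRestrict V.integer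
    fun a => (hV _).2 (P.zero_le_v_aeval hx a)
  refine (hV w).1 ((Valuation.integer.integers V).mem_of_integral ⟨r.map ψ, hr.map ψ, ?_⟩)
  rw [eval₂_map]
  exact hrw

/-- A function field of genus `0` with a place `P` is rational: `F = K(x)` for any nonconstant
`x ∈ L(P)`. An element `f` of `F` has a multiple `a(x) f` integral over `K[x]`, hence without poles
away from `P`, and such an element is a polynomial in `x`. -/
theorem exists_rational_generator [IsAlgClosed K] (hF : IsFunctionField K F)
    (hg : HasGenus K F 0) (P : Place K F) :
    ∃ x : F, Transcendental K x ∧ ∀ f : F, ∃ a b : K[X], b ≠ 0 ∧ f * aeval x b = aeval x a := by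
  classical
  have hfr : 2 ≤ finrank K (riemannRoch (Finsupp.single P 1 : Divisor K F)) := by
    have := hg.2 ⟨(Finsupp.single P 1 : Divisor K F), rfl⟩
    simp only [Divisor.degree, Finsupp.sum_single_index] at this
    omega
  obtain ⟨x, hxL, hxK⟩ : ∃ x ∈ riemannRoch (Finsupp.single P 1 : Divisor K F),
      x ∉ riemannRoch (0 : Divisor K F) := by
    by_contra! hle
    have h1 : riemannRoch (Finsupp.single P 1 : Divisor K F) ≤ Submodule.span K {1} := by
      intro f hf
      obtain ⟨c, rfl⟩ := exists_algebraMap_eq_of_mem_riemannRoch_zero hg (hle f hf)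
      exact Submodule.mem_span_singleton.2 ⟨c, by rw [Algebra.smul_def, mul_one]⟩
    have h2 := Submodule.finrank_mono h1
    have h3 := finrank_span_singleton (K := K) (one_ne_zero : (1 : F) ≠ 0)
    omega
  have hxt : Transcendental K x := fun halg => by
    obtain ⟨c, rfl⟩ := exists_algebraMap_eq_of_isAlgebraic halg
    exact hxK fun Q => by simpa using Q.zero_le_v_algebraMap c
  have hx0 : x ≠ 0 := fun h => hxt (h ▸ isAlgebraic_zero)
  have hxQ : ∀ Q : Place K F, Q ≠ P → 0 ≤ Q.v x := fun Q hQ => by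
    simpa [Finsupp.single_apply, hQ.symm] using hxL Q
  have hxP : P.v x = ((-1 : ℤ) : WithTop ℤ) := by
    have h1 : ((-1 : ℤ) : WithTop ℤ) ≤ P.v x := by simpa using hxL P
    refine le_antisymm ?_ h1
    by_contra hlt
    refine hxK fun Q => ?_
    by_cases hQ : Q = P
    · subst hQ
      obtain ⟨m, hm⟩ := WithTop.ne_top_iff_exists.1 (Q.v.ne_top_iff.2 hx0)
      rw [← hm] at hlt ⊢
      norm_cast at hlt ⊢
      simp only [Pi.zero_apply]
      omega
    · simpa using hxQ Q hQ
  have hinvP : P.v x⁻¹ = 1 := by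
    have : P.v (x * x⁻¹) = 0 := by rw [mul_inv_cancel₀ hx0, P.v.map_one]
    rw [AddValuation.map_mul, hxP] at this
    obtain ⟨m, hm⟩ := WithTop.ne_top_iff_exists.1 (P.v.ne_top_iff.2 (inv_ne_zero hx0))
    rw [← hm] at this ⊢
    norm_cast at this ⊢
    omega
  -- an element whose only pole is `P` is a polynomial in `x`: its leading term is removed by
  -- subtracting a multiple of a power of `x`
  have hpoly : ∀ (N : ℕ) (w : F), (∀ Q : Place K F, Q ≠ P → 0 ≤ Q.v w) →
      ((-N : ℤ) : WithTop ℤ) ≤ P.v w → ∃ a : K[X], aeval x a = w := by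
    intro N
    induction N with
    | zero =>
      intro w hw hwP
      obtain ⟨c, rfl⟩ := exists_algebraMap_eq_of_mem_riemannRoch_zero hg (f := w) fun Q => by
        by_cases hQ : Q = P
        · subst hQ; simpa using hwP
        · simpa using hw Q hQ
      exact ⟨C c, aeval_C _ _⟩
    | succ N ih =>
      intro w hw hwP
      have h1 : 0 ≤ P.v (w * x⁻¹ ^ (N + 1)) := by
        rw [AddValuation.map_mul, AddValuation.map_pow, hinvP]
        refine le_trans ?_ (add_le_add_left hwP _)
        rw [nsmul_one]
        norm_cast
        simp [Int.negSucc_eq]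
      obtain ⟨c, hc⟩ := P.exists_zero_lt_v_sub hF (t := x⁻¹)
        (fun h => hxt (by simpa using h.inv)) (by rw [hinvP]; exact zero_lt_one) h1
      have h2 : w - algebraMap K F c * x ^ (N + 1)
          = (w * x⁻¹ ^ (N + 1) - algebraMap K F c) * x ^ (N + 1) := by
        rw [sub_mul, mul_assoc, ← mul_pow, inv_mul_cancel₀ hx0, one_pow, mul_one]
      obtain ⟨a, ha⟩ := ih (w - algebraMap K F c * x ^ (N + 1)) (fun Q hQ => by
          refine Q.v.map_le_sub (hw Q hQ) ?_
          rw [AddValuation.map_mul]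
          exact add_nonneg (Q.zero_le_v_algebraMap c) (Q.zero_le_v_pow (hxQ Q hQ) _)) (by
          rw [h2, AddValuation.map_mul, AddValuation.map_pow, hxP]
          refine le_trans ?_ (add_le_add_left (WithTop.int_one_le_of_pos hc) _)
          rw [← WithTop.coe_nsmul]
          norm_cast
          simp)
      exact ⟨a + C c * X ^ (N + 1), by simp [ha]⟩
  refine ⟨x, hxt, fun f => ?_⟩
  let : Algebra K[X] F := (aeval x : K[X] →ₐ[K] F).toRingHom.toAlgebra
  have halg : IsAlgebraic K[X] f := hF.exists_relation hxt f
  obtain ⟨b, hb, hint⟩ := halg.exists_integral_multiple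
  have hbf : b • f = f * aeval x b := by rw [Algebra.smul_def, mul_comm]; rfl
  rw [hbf] at hint
  obtain ⟨N, hN⟩ : ∃ N : ℕ, ((-N : ℤ) : WithTop ℤ) ≤ P.v (f * aeval x b) := by
    generalize P.v (f * aeval x b) = m
    cases m with
    | top => exact ⟨0, le_top⟩
    | coe m => exact ⟨m.natAbs, by norm_cast; have := neg_abs_le m; omega⟩
  obtain ⟨a, ha⟩ := hpoly N _ (fun Q hQ => Q.zero_le_v_of_isIntegral (hxQ Q hQ) hint) hN
  exact ⟨a, b, hb, ha.symm⟩

/-! ### Linear independence on the general section -/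

/-- The generic member `g + λ y` of the pencil spanned by `g` and `y`, with `λ` the variable. -/
noncomputable def genericMember (g y : F) : F[X] := C g + X * C y

variable (K F) in
/-- Extension of the coefficients of polynomials in two variables `λ` (inner) and `τ` (outer). -/
noncomputable def extendCoeff : K[X][X] →+* F[X][X] := mapRingHom (mapRingHom (algebraMap K F))

variable (K) in
/-- The specialization `K[λ][τ] → F[λ]` at `τ = g + λ y`. -/
noncomputable def specialize (g y : F) : K[X][X] →+* F[X] :=
  (evalRingHom (genericMember g y)).comp (extendCoeff K F)

theorem specialize_apply (g y : F) (c : K[X][X]) :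
    specialize K g y c = (extendCoeff K F c).eval (genericMember g y) := rfl

theorem coeff_sum_extendCoeff {ι : Type*} (s : Finset ι) (c : ι → K[X][X]) (w : ι → F) (b a : ℕ) :
    ((∑ i ∈ s, extendCoeff K F (c i) * C (C (w i))).coeff b).coeff a
      = ∑ i ∈ s, ((c i).coeff b).coeff a • w i := by
  simp [extendCoeff, Algebra.smul_def]

theorem eq_zero_of_sum_extendCoeff_eq_zero {ι : Type*} {s : Finset ι} {c : ι → K[X][X]}
    {w : ι → F} (hw : LinearIndependent K w)
    (h : ∑ i ∈ s, extendCoeff K F (c i) * C (C (w i)) = 0) : ∀ i ∈ s, c i = 0 := by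
  intro i hi
  ext b a
  have := coeff_sum_extendCoeff s c w b a
  rw [h] at this
  simpa using linearIndependent_iff'.1 hw s _ this.symm i hi

section Quotient

variable {g y : F} {q f : F[X][X]}

theorem coeff_mul_sub_genericMember (hf : (X - C (genericMember g y)) * q = f) (b a : ℕ) :
    (f.coeff b).coeff a = ((X * q).coeff b).coeff a - g * (q.coeff b).coeff a
      - y * (X * q.coeff b).coeff a := by
  rw [← hf, sub_mul, coeff_sub, coeff_C_mul, coeff_sub, genericMember, add_mul, coeff_add,
    coeff_C_mul, mul_right_comm, mul_comm _ (C y), coeff_C_mul]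
  ring

/-- Induction on the coefficients of a quotient by `τ - (g + λ y)`, from the lowest ones up. -/
theorem coeff_quotient_induction (hf : (X - C (genericMember g y)) * q = f) (p : F → Prop)
    (h0 : p 0)
    (hstep : ∀ b a z₁ z₂, p z₁ → p z₂ →
      (f.coeff b).coeff a = z₁ - g * (q.coeff b).coeff a - y * z₂ → p ((q.coeff b).coeff a))
    (b a : ℕ) : p ((q.coeff b).coeff a) := by
  induction b generalizing a with
  | zero =>
    induction a with
    | zero => exact hstep 0 0 _ _ h0 h0 (by simpa using coeff_mul_sub_genericMember hf 0 0)
    | succ a iha =>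
      exact hstep 0 (a + 1) _ _ h0 iha (by simpa using coeff_mul_sub_genericMember hf 0 (a + 1))
  | succ b ihb =>
    induction a with
    | zero =>
      exact hstep (b + 1) 0 _ _ (ihb 0) h0
        (by simpa using coeff_mul_sub_genericMember hf (b + 1) 0)
    | succ a iha =>
      exact hstep (b + 1) (a + 1) _ _ (ihb _) iha
        (by simpa using coeff_mul_sub_genericMember hf (b + 1) (a + 1))

/-- Induction on the coefficients of a quotient by `τ - (g + λ y)`, from the highest powers of `τ`
down. -/
theorem coeff_quotient_induction_down (hf : (X - C (genericMember g y)) * q = f) (p : F → Prop)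
    (h0 : p 0)
    (hstep : ∀ b a z₁ z₂, p z₁ → p z₂ → p ((f.coeff b).coeff a + g * z₁ + y * z₂))
    (b a : ℕ) : p ((q.coeff b).coeff a) := by
  suffices H : ∀ j b, q.natDegree < b + j → ∀ a, p ((q.coeff b).coeff a) from
    H (q.natDegree + 1) b (by omega) a
  intro j
  induction j with
  | zero =>
    intro b hb a
    rw [coeff_eq_zero_of_natDegree_lt (show q.natDegree < b by omega)]
    simpa using h0
  | succ j ih =>
    intro b hb a
    have hrec := coeff_mul_sub_genericMember hf (b + 1) a
    rw [coeff_X_mul] at hrec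
    have : (q.coeff b).coeff a = (f.coeff (b + 1)).coeff a + g * (q.coeff (b + 1)).coeff a
        + y * (X * q.coeff (b + 1)).coeff a := by rw [hrec]; ring
    rw [this]
    refine hstep _ _ _ _ (ih _ (by omega) _) ?_
    cases a with
    | zero => simpa using h0
    | succ a => simpa using ih (b + 1) (by omega) a

/-- If `g` has the poles prescribed by `D`, then the coefficients of a quotient by `τ - (g + λ y)`
have no poles as soon as those of the dividend lie in `L(D)`. -/
theorem coeff_quotient_mem_riemannRoch_zero {D : Divisor K F} (h1 : (1 : F) ∈ riemannRoch D)
    (hg : g ∈ riemannRoch D) (hy : y ∈ riemannRoch D)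
    (hgD : ∀ Q : Place K F, D Q ≠ 0 → Q.v g = ((-D Q : ℤ) : WithTop ℤ))
    (hf : (X - C (genericMember g y)) * q = f)
    (hfD : ∀ b a, (f.coeff b).coeff a ∈ riemannRoch D) (b a : ℕ) :
    (q.coeff b).coeff a ∈ riemannRoch (0 : Divisor K F) := by
  intro Q
  simp only [Finsupp.coe_zero, Pi.zero_apply, neg_zero, WithTop.coe_zero]
  have hnn : ∀ z w : F, ((-D Q : ℤ) : WithTop ℤ) ≤ Q.v z → 0 ≤ Q.v w →
      ((-D Q : ℤ) : WithTop ℤ) ≤ Q.v (z * w) := fun z w hz hw => by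
    rw [AddValuation.map_mul]
    exact le_add_of_le_of_nonneg hz hw
  by_cases hD : D Q = 0
  · refine coeff_quotient_induction_down hf (fun z => 0 ≤ Q.v z) (by simp) ?_ b a
    intro b a z₁ z₂ hz₁ hz₂
    have := Q.v.map_le_add (Q.v.map_le_add (hfD b a Q) (hnn g z₁ (hg Q) hz₁))
      (hnn y z₂ (hy Q) hz₂)
    simpa [hD] using this
  · refine coeff_quotient_induction hf (fun z => 0 ≤ Q.v z) (by simp) ?_ b a
    intro b a z₁ z₂ hz₁ hz₂ hrec
    have hgz : g * (q.coeff b).coeff a = z₁ - (f.coeff b).coeff a - y * z₂ := by rw [hrec]; ring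
    have hle : ((-D Q : ℤ) : WithTop ℤ) ≤ Q.v (g * (q.coeff b).coeff a) := by
      rw [hgz]
      refine Q.v.map_le_sub (Q.v.map_le_sub ?_ (hfD b a Q)) (hnn y z₂ (hy Q) hz₂)
      simpa using hnn 1 z₁ (h1 Q) hz₁
    rw [AddValuation.map_mul, hgD Q hD] at hle
    generalize Q.v ((q.coeff b).coeff a) = m at hle ⊢
    cases m with
    | top => exact le_top
    | coe m =>
      norm_cast at hle ⊢
      omega

end Quotient

/-- Let `g` have the poles prescribed by `D`, and let `W ⊆ L(D)` not contain `g`. Then a family in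
`W` that is independent over `K` stays independent over the polynomials in `λ` and `g + λ y`. -/
theorem eq_zero_of_sum_specialize_eq_zero [IsAlgClosed K] (hgen : HasGenus K F 0) {g y : F}
    {D : Divisor K F} (h1 : (1 : F) ∈ riemannRoch D)
    (hg : g ∈ riemannRoch D) (hy : y ∈ riemannRoch D)
    (hgD : ∀ Q : Place K F, D Q ≠ 0 → Q.v g = ((-D Q : ℤ) : WithTop ℤ))
    {W : Submodule K F} (hW : W ≤ riemannRoch D) (hgW : g ∉ W)
    {ι : Type*} {w : ι → F} (hw : LinearIndependent K w) (hwW : ∀ i, w i ∈ W)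
    {s : Finset ι} {c : ι → K[X][X]}
    (h : ∑ i ∈ s, specialize K g y (c i) * C (w i) = 0) : ∀ i ∈ s, c i = 0 := by
  refine eq_zero_of_sum_extendCoeff_eq_zero hw ?_
  set f := ∑ i ∈ s, extendCoeff K F (c i) * C (C (w i)) with hf
  have hfW : ∀ b a, (f.coeff b).coeff a ∈ W := fun b a => by
    rw [hf, coeff_sum_extendCoeff]
    exact W.sum_mem fun i _ => W.smul_mem _ (hwW i)
  obtain ⟨q, hq⟩ : X - C (genericMember g y) ∣ f := by
    rw [dvd_iff_isRoot, IsRoot.def, hf, eval_finsetSum]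
    simpa [specialize_apply] using h
  have hqK := coeff_quotient_mem_riemannRoch_zero h1 hg hy hgD hq.symm fun b a => hW (hfW b a)
  -- for constant coefficients `z` of `q` the recurrence leaves `g z ∈ W`, so that `z = 0`
  have hq0 : q = 0 := by
    ext b a
    rw [coeff_zero, coeff_zero]
    refine coeff_quotient_induction hq.symm (fun z => z = 0) rfl ?_ b a
    rintro b a _ _ rfl rfl hrec
    obtain ⟨t, ht⟩ := exists_algebraMap_eq_of_mem_riemannRoch_zero hgen (hqK b a)
    have hfw := hfW b a
    rw [hrec, ← ht] at hfw
    rw [← ht]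
    rw [mul_zero, sub_zero, zero_sub, neg_mem_iff, mul_comm, ← Algebra.smul_def] at hfw
    by_contra ht0
    exact hgW ((W.smul_mem_iff fun h => ht0 (by rw [h, map_zero])).1 hfw)
  rw [hq, hq0, mul_zero]

section FractionFields

variable {k E : Type*} [Field k] [Field E] [Algebra k E] [Algebra K[X][X] k]
  [Algebra F[X] E] {g y : F}

/-- The inclusion of `F` into the field `E` of rational functions in `λ` over `F`. -/
noncomputable def constHom (F E : Type*) [Field F] [Field E] [Algebra F[X] E] : F →+* E :=
  (algebraMap F[X] E).comp C

theorem linearIndependent_constHom [IsFractionRing K[X][X] k] [IsFractionRing F[X] E] [IsAlgClosed K] (hgen : HasGenus K F 0)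
    (hc : ∀ c : K[X][X], algebraMap k E (algebraMap K[X][X] k c)
      = algebraMap F[X] E (specialize K g y c))
    {D : Divisor K F} (h1 : (1 : F) ∈ riemannRoch D)
    (hg : g ∈ riemannRoch D) (hy : y ∈ riemannRoch D)
    (hgD : ∀ Q : Place K F, D Q ≠ 0 → Q.v g = ((-D Q : ℤ) : WithTop ℤ))
    {W : Submodule K F} (hW : W ≤ riemannRoch D) (hgW : g ∉ W)
    {ι : Type*} {w : ι → F} (hw : LinearIndependent K w) (hwW : ∀ i, w i ∈ W) :
    LinearIndependent k fun i => constHom F E (w i) := by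
  let : Algebra K[X][X] E := ((algebraMap k E).comp (algebraMap K[X][X] k)).toAlgebra
  have : IsScalarTower K[X][X] k E := .of_algebraMap_eq' rfl
  rw [← LinearIndependent.iff_fractionRing K[X][X] k, linearIndependent_iff']
  intro s c hsum
  refine eq_zero_of_sum_specialize_eq_zero hgen h1 hg hy hgD hW hgW hw hwW
    (IsFractionRing.injective F[X] E ?_)
  rw [map_zero, ← hsum, map_sum]
  refine Finset.sum_congr rfl fun i _ => ?_
  rw [map_mul, ← hc, Algebra.smul_def]
  rfl

theorem constHom_algebraMap (hc : ∀ c : K[X][X], algebraMap k E (algebraMap K[X][X] k c)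
      = algebraMap F[X] E (specialize K g y c)) (c : K) :
    constHom F E (algebraMap K F c) = algebraMap k E (algebraMap K[X][X] k (C (C c))) := by
  rw [hc]
  simp [specialize_apply, extendCoeff, constHom]

variable (k E) in
/-- The `k`-span of a subset of `F` in `E`. -/
noncomputable def constSpan (V : Set F) : Submodule k E := Submodule.span k (constHom F E '' V)

/-- The relations `(τ - g - λ y) s = 0` for `s ∈ V` are independent over `K(λ, τ)`. Hence
`dim_K T ≥ dim_K V + dim_k (k T)` if `T` contains `V`, `g V` and `y V`. -/
theorem finrank_add_finrank_constSpan_le [IsFractionRing K[X][X] k]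
    (hc : ∀ c : K[X][X], algebraMap k E (algebraMap K[X][X] k c)
      = algebraMap F[X] E (specialize K g y c))
    (V T : Submodule K F) [FiniteDimensional K V] [FiniteDimensional K T] (hVT : V ≤ T)
    (hgV : ∀ s ∈ V, g * s ∈ T) (hyV : ∀ s ∈ V, y * s ∈ T) :
    finrank K V + finrank k (constSpan k E (T : Set F)) ≤ finrank K T := by
  let z := Module.finBasis K T
  let s := Module.finBasis K V
  let ζ : Fin (finrank K T) → E := fun i => constHom F E (z i)
  let ρ : Fin (finrank K V) → Fin (finrank K T) → K[X][X] := fun j i =>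
    X * C (C (z.repr ⟨s j, hVT (s j).2⟩ i)) - C (C (z.repr ⟨g * s j, hgV _ (s j).2⟩ i))
      - C (X * C (z.repr ⟨y * s j, hyV _ (s j).2⟩ i))
  have hz : ∀ t : T, ∑ i, algebraMap K F (z.repr t i) * z i = t := fun t => by
    have := congrArg (Submodule.subtype T) (z.sum_repr t)
    rw [map_sum] at this
    simpa only [map_smul, Submodule.subtype_apply, Algebra.smul_def] using this
  -- expansion of `(τ - g - λ y) s_j` in the basis of `T`
  have hρ : ∀ j, ∑ i, extendCoeff K F (ρ j i) * C (C (z i : F))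
      = (X - C (genericMember g y)) * C (C (s j : F)) := fun j => by
    have e1 := hz ⟨s j, hVT (s j).2⟩
    have e2 := hz ⟨g * s j, hgV _ (s j).2⟩
    have e3 := hz ⟨y * s j, hyV _ (s j).2⟩
    have hterm : ∀ i, extendCoeff K F (ρ j i) * C (C (z i : F))
        = X * C (C (algebraMap K F (z.repr ⟨s j, hVT (s j).2⟩ i) * z i))
        - C (C (algebraMap K F (z.repr ⟨g * s j, hgV _ (s j).2⟩ i) * z i))
        - C (X * C (algebraMap K F (z.repr ⟨y * s j, hyV _ (s j).2⟩ i) * z i)) := fun i => by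
      simp [ρ, extendCoeff]
      ring
    rw [Finset.sum_congr rfl fun i _ => hterm i, Finset.sum_sub_distrib, Finset.sum_sub_distrib,
      ← Finset.mul_sum, ← map_sum, ← map_sum, ← map_sum, ← map_sum, ← map_sum, ← Finset.mul_sum,
      ← map_sum, e1, e2, e3]
    simp only [genericMember, map_add, map_mul]
    ring
  let L : (Fin (finrank K T) → k) →ₗ[k] E := Fintype.linearCombination k ζ
  have hker : ∀ j, (fun i => algebraMap K[X][X] k (ρ j i)) ∈ LinearMap.ker L := fun j => by
    have h := congrArg (fun p => algebraMap F[X] E (p.eval (genericMember g y))) (hρ j)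
    simp only [eval_finsetSum, eval_mul, eval_C, eval_sub, eval_X, sub_self, zero_mul,
      map_zero, map_sum, map_mul] at h
    rw [LinearMap.mem_ker, ← h]
    simp only [L, Fintype.linearCombination_apply, Algebra.smul_def, hc]
    rfl
  have hind : LinearIndependent k fun j =>
      (⟨fun i => algebraMap K[X][X] k (ρ j i), hker j⟩ : LinearMap.ker L) := by
    refine LinearIndependent.of_comp (LinearMap.ker L).subtype ?_
    rw [← LinearIndependent.iff_fractionRing K[X][X] k, Fintype.linearIndependent_iff]
    intro c hsum
    have hcol : ∀ i, ∑ j, c j * ρ j i = 0 := fun i => by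
      have := congrFun hsum i
      refine IsFractionRing.injective K[X][X] k ?_
      simpa [Algebra.smul_def] using this
    have hq : (X - C (genericMember g y)) * ∑ j, extendCoeff K F (c j) * C (C (s j : F)) = 0 := by
      have h1 : ∀ j, (X - C (genericMember g y)) * (extendCoeff K F (c j) * C (C (s j : F)))
          = ∑ i, extendCoeff K F (c j * ρ j i) * C (C (z i : F)) := fun j => by
        rw [mul_left_comm, ← hρ, Finset.mul_sum]
        simp only [map_mul, mul_assoc]
      rw [Finset.mul_sum, Finset.sum_congr rfl fun j _ => h1 j, Finset.sum_comm]
      refine Finset.sum_eq_zero fun i _ => ?_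
      rw [← Finset.sum_mul, ← map_sum, hcol, map_zero, zero_mul]
    have hs : LinearIndependent K fun j => (s j : F) :=
      s.linearIndependent.map' V.subtype V.ker_subtype
    exact fun j => eq_zero_of_sum_extendCoeff_eq_zero hs
      ((mul_eq_zero.1 hq).resolve_left (X_sub_C_ne_zero _)) j (Finset.mem_univ j)
  have hrange : constSpan k E (T : Set F) ≤ LinearMap.range L := by
    rw [Fintype.range_linearCombination, constSpan, Submodule.span_le]
    rintro _ ⟨t, ht, rfl⟩
    have htz : _ = t := hz ⟨t, ht⟩
    rw [← htz, map_sum]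
    refine Submodule.sum_mem _ fun i _ => ?_
    rw [map_mul, constHom_algebraMap hc, ← Algebra.smul_def]
    exact Submodule.smul_mem _ _ (Submodule.subset_span ⟨i, rfl⟩)
  have h1 := hind.fintype_card_le_finrank
  have h2 := L.finrank_range_add_finrank_ker
  have h3 := Submodule.finrank_mono hrange
  simp only [Fintype.card_fin, finrank_fin_fun] at h1 h2
  omega

end FractionFields

/-! ### Irreducibility of the general section -/

/-- Two elements of `K(x)` have representations as fractions with the same denominator and without
a factor common to both numerators and the denominator. -/
theorem exists_common_denominator {x : F} (hxt : Transcendental K x)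
    (hx : ∀ f : F, ∃ a b : K[X], b ≠ 0 ∧ f * aeval x b = aeval x a) (g y : F) :
    ∃ G Y H : K[X], H ≠ 0 ∧ g * aeval x H = aeval x G ∧ y * aeval x H = aeval x Y ∧
      ∃ a b c : K[X], a * G + b * Y + c * H = 1 := by
  have hinj : Function.Injective (aeval x : K[X] →ₐ[K] F) := transcendental_iff_injective.1 hxt
  obtain ⟨a₁, b₁, hb₁, h₁⟩ := hx g
  obtain ⟨a₂, b₂, hb₂, h₂⟩ := hx y
  let I : Ideal K[X] := Ideal.span {a₁ * b₂, a₂ * b₁, b₁ * b₂}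
  set d := Submodule.IsPrincipal.generator I with hd
  have hdvd : ∀ z ∈ I, d ∣ z := fun z hz => (Submodule.IsPrincipal.mem_iff_generator_dvd I).1 hz
  obtain ⟨G, hG⟩ := hdvd (a₁ * b₂) (Ideal.subset_span (by simp))
  obtain ⟨Y, hY⟩ := hdvd (a₂ * b₁) (Ideal.subset_span (by simp))
  obtain ⟨H, hH⟩ := hdvd (b₁ * b₂) (Ideal.subset_span (by simp))
  have hdH : d * H ≠ 0 := hH ▸ mul_ne_zero hb₁ hb₂
  have hd0 : d ≠ 0 := left_ne_zero_of_mul hdH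
  have hdx : aeval x d ≠ 0 := fun h => hd0 (hinj (by simpa using h))
  refine ⟨G, Y, H, right_ne_zero_of_mul hdH, ?_, ?_, ?_⟩
  · refine mul_left_cancel₀ hdx ?_
    have e1 := congrArg (aeval x) hG
    have e2 := congrArg (aeval x) hH
    simp only [map_mul] at e1 e2
    rw [← e1, ← h₁, mul_left_comm, ← e2]
    ring
  · refine mul_left_cancel₀ hdx ?_
    have e1 := congrArg (aeval x) hY
    have e2 := congrArg (aeval x) hH
    simp only [map_mul] at e1 e2
    rw [← e1, ← h₂, mul_left_comm, ← e2]
    ring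
  · obtain ⟨a, b, c, habc⟩ := Submodule.mem_span_triple.1
      (Submodule.IsPrincipal.generator_mem I)
    refine ⟨a, b, c, mul_left_cancel₀ hd0 ?_⟩
    rw [← hd, smul_eq_mul, smul_eq_mul, smul_eq_mul, hG, hY, hH] at habc
    rw [mul_one]
    conv_rhs => rw [← habc]
    ring

/-- If `g` and `y` generate `F = K(x)`, then `x` is the only common zero, with multiplicity one, of
`G - g H` and `Y - y H`. Indeed modulo a common divisor of these polynomials the elements
of `K(x)` that keep their value under `x ↦ T` form a field containing `g` and `y`. -/
theorem dvd_X_sub_C_of_dvd [IsAlgClosed K] {x g y : F} (hxt : Transcendental K x)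
    (hgen : ∀ M : IntermediateField K F, g ∈ M → y ∈ M → M = ⊤)
    (hyK : ∀ c : K, algebraMap K F c ≠ y)
    {G Y H : K[X]} (hH : H ≠ 0) (hG : g * aeval x H = aeval x G) (hY : y * aeval x H = aeval x Y)
    (hGYH : ∃ a b c : K[X], a * G + b * Y + c * H = 1) {D : F[X]}
    (hDG : D ∣ G.map (algebraMap K F) - C g * H.map (algebraMap K F))
    (hDY : D ∣ Y.map (algebraMap K F) - C y * H.map (algebraMap K F))
    (hD : X - C x ∣ D) : D ∣ X - C x := by
  have hcop : ∀ a : K[X], a ≠ 0 → IsCoprime (a.map (algebraMap K F)) D := by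
    intro a ha
    induction hn : a.natDegree generalizing a with
    | zero =>
      rw [eq_C_of_natDegree_eq_zero hn] at ha ⊢
      rw [map_C]
      have hu : algebraMap K F (a.coeff 0) ≠ 0 := by simpa using ha
      exact ⟨C (algebraMap K F (a.coeff 0))⁻¹, 0, by
        rw [← C_mul, inv_mul_cancel₀ hu, C_1, zero_mul, add_zero]⟩
    | succ n ih =>
      obtain ⟨c, hc⟩ := IsAlgClosed.exists_root a (by
        rw [degree_eq_natDegree ha, hn]; exact_mod_cast n.succ_ne_zero)
      obtain ⟨a', rfl⟩ := dvd_iff_isRoot.2 hc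
      have ha'0 : a' ≠ 0 := right_ne_zero_of_mul ha
      rw [natDegree_mul (X_sub_C_ne_zero c) ha'0, natDegree_X_sub_C] at hn
      rw [Polynomial.map_mul]
      refine IsCoprime.mul_left ?_ (ih a' ha'0 (by omega))
      rw [Polynomial.map_sub, map_X, map_C, (irreducible_X_sub_C _).coprime_iff_not_dvd]
      intro hdvd
      have hroot : ∀ (z : F) (Z : K[X]),
          D ∣ Z.map (algebraMap K F) - C z * H.map (algebraMap K F) →
          algebraMap K F (Z.eval c) = z * algebraMap K F (H.eval c) := fun z Z hZ => by
        have := dvd_iff_isRoot.1 (hdvd.trans hZ)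
        simpa [sub_eq_zero, eval_map_algebraMap, aeval_algebraMap_apply] using this
      have e1 := hroot g G hDG
      have e2 := hroot y Y hDY
      by_cases hHc : H.eval c = 0
      · rw [hHc, map_zero, mul_zero, map_eq_zero] at e1 e2
        obtain ⟨u, v, w, huvw⟩ := hGYH
        have := congrArg (eval c) huvw
        simp [e1, e2, hHc] at this
      · refine hyK (Y.eval c / H.eval c) ?_
        have : algebraMap K F (H.eval c) ≠ 0 := by simpa using hHc
        rw [map_div₀, e2, mul_div_cancel_right₀ _ this]
  have hDu : ¬ IsUnit D := fun h => not_isUnit_X_sub_C x (isUnit_of_dvd_unit hD h)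
  have hΩ : Nontrivial (AdjoinRoot D) := Ideal.Quotient.nontrivial_iff.2 (by
    rwa [Ne, Ideal.span_singleton_eq_top])
  set ξ : AdjoinRoot D := AdjoinRoot.root D with hξ
  have hmk : ∀ a : K[X], AdjoinRoot.mk D (a.map (algebraMap K F)) = aeval ξ a := fun a => by
    rw [← AdjoinRoot.aeval_eq, aeval_map_algebraMap]
  have hunit : ∀ a : K[X], a ≠ 0 → IsUnit (aeval ξ a) := fun a ha => by
    obtain ⟨u, v, huv⟩ := hcop a ha
    have := congrArg (AdjoinRoot.mk D) huv
    rw [map_add, map_mul, map_mul, AdjoinRoot.mk_self, mul_zero, add_zero, map_one, hmk] at this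
    exact IsUnit.of_mul_eq_one_right _ this
  have hinj : Function.Injective (aeval x : K[X] →ₐ[K] F) := transcendental_iff_injective.1 hxt
  let ι : F →+* AdjoinRoot D := AdjoinRoot.of D
  have hιK : ∀ c : K, ι (algebraMap K F c) = algebraMap K (AdjoinRoot D) c := fun c => rfl
  -- the elements `a(x) / b(x)` that agree with `a(T) / b(T)` modulo `D`
  let M : IntermediateField K F :=
    { carrier := {f | ∃ a b : K[X], b ≠ 0 ∧ f * aeval x b = aeval x a ∧
        ι f * aeval ξ b = aeval ξ a}
      mul_mem' := by
        rintro f₁ f₂ ⟨a₁, b₁, hb₁, h₁, h₁'⟩ ⟨a₂, b₂, hb₂, h₂, h₂'⟩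
        refine ⟨a₁ * a₂, b₁ * b₂, mul_ne_zero hb₁ hb₂, ?_, ?_⟩
        · rw [map_mul, map_mul, ← h₁, ← h₂]; ring
        · rw [map_mul, map_mul, map_mul, ← h₁', ← h₂']; ring
      add_mem' := by
        rintro f₁ f₂ ⟨a₁, b₁, hb₁, h₁, h₁'⟩ ⟨a₂, b₂, hb₂, h₂, h₂'⟩
        refine ⟨a₁ * b₂ + a₂ * b₁, b₁ * b₂, mul_ne_zero hb₁ hb₂, ?_, ?_⟩
        · simp only [map_mul, map_add, ← h₁, ← h₂]; ring
        · simp only [map_mul, map_add, ← h₁', ← h₂']; ring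
      algebraMap_mem' := fun c => ⟨C c, 1, one_ne_zero, by simp, by simp [hιK]⟩
      inv_mem' := by
        rintro f ⟨a, b, hb, h, h'⟩
        by_cases hf : f = 0
        · exact ⟨0, 1, one_ne_zero, by simp [hf], by simp [hf]⟩
        have ha : a ≠ 0 := by
          rintro rfl
          rw [map_zero, mul_eq_zero] at h
          exact h.elim hf fun h => hb (hinj (by simpa using h))
        refine ⟨b, a, ha, ?_, ?_⟩
        · rw [← h, inv_mul_cancel_left₀ hf]
        · rw [← h', ← mul_assoc, ← map_mul, inv_mul_cancel₀ hf, map_one, one_mul] }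
  have hmem : ∀ (z : F) (Z : K[X]), z * aeval x H = aeval x Z →
      D ∣ Z.map (algebraMap K F) - C z * H.map (algebraMap K F) → z ∈ M := fun z Z hZ hDZ => by
    refine ⟨Z, H, hH, hZ, ?_⟩
    have := AdjoinRoot.mk_eq_zero.2 hDZ
    rw [map_sub, map_mul, hmk, hmk, AdjoinRoot.mk_C, sub_eq_zero] at this
    exact this.symm
  have hxM : x ∈ M := by
    rw [hgen M (hmem g G hG hDG) (hmem y Y hY hDY)]
    exact IntermediateField.mem_top
  obtain ⟨a, b, hb, h, h'⟩ := hxM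
  have hab : X * b = a := hinj (by simpa using h)
  rw [← hab, map_mul, aeval_X] at h'
  have hxξ := (hunit b hb).mul_right_cancel h'
  rw [← AdjoinRoot.mk_eq_zero, map_sub, AdjoinRoot.mk_X, AdjoinRoot.mk_C, sub_eq_zero]
  exact hxξ.symm

/-- For coprime polynomials `A` and `B` the generic combination `A + λ B` is irreducible over
the field of rational functions in `λ`, or constant. -/
theorem natDegree_eq_zero_or_irreducible_map {E : Type*} [Field E] [Algebra F[X] E]
    [IsFractionRing F[X] E] {A B : F[X]} (hAB : IsRelPrime A B) (hB : B ≠ 0) :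
    (A.map (C : F →+* F[X]) + C X * B.map (C : F →+* F[X])).natDegree = 0 ∨
      Irreducible ((A.map (C : F →+* F[X]) + C X * B.map (C : F →+* F[X])).map
        (algebraMap F[X] E)) := by
  have hirr : Irreducible (A.map (C : F →+* F[X]) + C X * B.map (C : F →+* F[X])) := by
    have h : Irreducible (C A + X * C B : F[X][X]) := by
      refine irreducible_of_degree_eq_one_of_isRelPrime_coeff ?_ (by simpa using hAB)
      rw [add_comm, mul_comm, degree_linear hB]
    rw [← MulEquiv.irreducible_iff (Bivariate.swap (R := F))] at h
    simpa only [map_add, map_mul, Bivariate.swap_C, Bivariate.swap_Y] using h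
  by_cases h0 : (A.map (C : F →+* F[X]) + C X * B.map (C : F →+* F[X])).natDegree = 0
  · exact Or.inl h0
  · exact Or.inr (((hirr.isPrimitive h0).irreducible_iff_irreducible_map_fraction_map).1 hirr)

/-! ### Absence of intermediate fields -/

/-- Let `E = k(x)`, and let `x` be a zero of a polynomial over `k` which factors over `E` as
`(T - x) Θ` with `Θ` constant or irreducible. Then `E / k` has no proper intermediate fields: the
minimal polynomial of `x` over such a field could only be `T - x` or the whole polynomial. -/
theorem eq_bot_or_eq_top_of_irreducible {k E : Type*} [Field k] [Field E] [Algebra k E] {x : E}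
    (htop : IntermediateField.adjoin k {x} = ⊤) {p : k[X]} {Θ : E[X]} (hp0 : p ≠ 0)
    (hp : p.map (algebraMap k E) = (X - C x) * Θ) (hΘ : Θ.natDegree = 0 ∨ Irreducible Θ) :
    FiniteDimensional k E ∧ ∀ M : IntermediateField k E, M = ⊥ ∨ M = ⊤ := by
  have hpx : aeval x p = 0 := by
    rw [← eval_map_algebraMap, hp]; simp
  have hint : IsIntegral k x := (show IsAlgebraic k x from ⟨p, hp0, hpx⟩).isIntegral
  have hfin : FiniteDimensional k E := by
    have := IntermediateField.adjoin.finiteDimensional hint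
    rw [htop] at this
    exact Module.Finite.equiv (IntermediateField.topEquiv (F := k) (E := E)).toLinearEquiv
  refine ⟨hfin, fun M => ?_⟩
  have hintM : IsIntegral M x := hint.tower_top
  have hΘ0 : Θ ≠ 0 := fun h => hp0 (by simpa [h] using hp)
  obtain ⟨r, hr⟩ : (minpoly M x).map (algebraMap M E) ∣ (X - C x) * Θ := by
    rw [← hp, IsScalarTower.algebraMap_eq k M E, ← Polynomial.map_map]
    refine Polynomial.map_dvd _ (minpoly.dvd M x ?_)
    rw [aeval_map_algebraMap, hpx]
  obtain ⟨Q, hQ⟩ : X - C x ∣ (minpoly M x).map (algebraMap M E) := by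
    rw [dvd_iff_isRoot, IsRoot.def, eval_map_algebraMap, minpoly.aeval]
  have hQ0 : Q ≠ 0 := by
    rintro rfl
    rw [mul_zero, Polynomial.map_eq_zero] at hQ
    exact minpoly.ne_zero hintM hQ
  have hdeg : (minpoly M x).natDegree = 1 + Q.natDegree := by
    rw [← natDegree_map (algebraMap M E), hQ, natDegree_mul (X_sub_C_ne_zero x) hQ0,
      natDegree_X_sub_C]
  have hΘr : Θ = Q * r := by
    rw [hQ, mul_assoc] at hr
    exact mul_left_cancel₀ (X_sub_C_ne_zero x) hr
  have hr0 : r ≠ 0 := fun h => hΘ0 (by rw [hΘr, h, mul_zero])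
  have hΘdeg : Θ.natDegree = Q.natDegree + r.natDegree := by rw [hΘr, natDegree_mul hQ0 hr0]
  have hcases : Q.natDegree = 0 ∨ Θ.natDegree ≤ Q.natDegree := by
    rcases hΘ with h | h
    · left; omega
    · rcases h.isUnit_or_isUnit hΘr with h | h
      · exact Or.inl (natDegree_eq_zero_of_isUnit h)
      · right; have := natDegree_eq_zero_of_isUnit h; omega
  rcases hcases with h | h
  · right
    obtain ⟨z, hz⟩ := minpoly.mem_range_of_degree_eq_one M x (by
      rw [degree_eq_natDegree (minpoly.ne_zero hintM), hdeg, h]; rfl)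
    rw [eq_top_iff, ← htop, IntermediateField.adjoin_le_iff, Set.singleton_subset_iff]
    rw [← hz]
    exact z.2
  · left
    have h1 : (minpoly k x).natDegree ≤ 1 + Θ.natDegree := by
      have := natDegree_le_of_dvd (minpoly.dvd k x hpx) hp0
      rwa [← natDegree_map (algebraMap k E) (p := p), hp,
        natDegree_mul (X_sub_C_ne_zero x) hΘ0, natDegree_X_sub_C] at this
    have h2 := (Field.primitive_element_iff_minpoly_natDegree_eq k x).1 htop
    have h3 := (Field.primitive_element_iff_minpoly_natDegree_eq M x).1
      (IntermediateField.adjoin_eq_top_of_adjoin_eq_top k htop)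
    have h4 := finrank_mul_finrank k M E
    have h5 : 0 < finrank M E := finrank_pos
    have h6 : 0 < finrank k M := finrank_pos
    rw [← IntermediateField.finrank_eq_one_iff]
    nlinarith

/-- If `g` and `y` generate `F`, then there are no proper intermediate fields between
`k = K(λ, g + λ y)` and `E = F(λ)`. -/
theorem eq_bot_or_eq_top_of_specialize [IsAlgClosed K] {k E : Type*} [Field k] [Field E]
    [Algebra k E] [Algebra K[X][X] k] [Algebra F[X] E] [IsFractionRing F[X] E] {x g y : F}
    (hc : ∀ c : K[X][X], algebraMap k E (algebraMap K[X][X] k c)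
      = algebraMap F[X] E (specialize K g y c))
    (hxt : Transcendental K x)
    (hx : ∀ f : F, ∃ a b : K[X], b ≠ 0 ∧ f * aeval x b = aeval x a)
    (hgen : ∀ M : IntermediateField K F, g ∈ M → y ∈ M → M = ⊤)
    (hyK : ∀ c : K, algebraMap K F c ≠ y) :
    FiniteDimensional k E ∧ ∀ M : IntermediateField k E, M = ⊥ ∨ M = ⊤ := by
  obtain ⟨G, Y, H, hH, hG, hY, hGYH⟩ := exists_common_denominator hxt hx g y
  set A₀ := G.map (algebraMap K F) - C g * H.map (algebraMap K F) with hA₀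
  set B₀ := Y.map (algebraMap K F) - C y * H.map (algebraMap K F) with hB₀
  obtain ⟨A, hA⟩ : X - C x ∣ A₀ := by
    rw [dvd_iff_isRoot, IsRoot.def, hA₀]
    simp [eval_map_algebraMap, hG]
  obtain ⟨B, hB⟩ : X - C x ∣ B₀ := by
    rw [dvd_iff_isRoot, IsRoot.def, hB₀]
    simp [eval_map_algebraMap, hY]
  have hB₀0 : B₀ ≠ 0 := by
    intro h
    obtain ⟨i, hi⟩ : ∃ i, H.coeff i ≠ 0 := by
      by_contra! hall
      exact hH (Polynomial.ext fun i => by simpa using hall i)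
    have := congrArg (fun p => p.coeff i) h
    simp only [hB₀, coeff_sub, coeff_map, coeff_C_mul, coeff_zero, sub_eq_zero] at this
    refine hyK (Y.coeff i / H.coeff i) ?_
    have hi' : algebraMap K F (H.coeff i) ≠ 0 := by simpa using hi
    rw [map_div₀, this, mul_div_cancel_right₀ _ hi']
  have hB0 : B ≠ 0 := fun h => hB₀0 (by rw [hB, h, mul_zero])
  have hAB : IsRelPrime A B := by
    intro e heA heB
    obtain ⟨r, hr⟩ := dvd_X_sub_C_of_dvd hxt hgen hyK hH hG hY hGYH (D := (X - C x) * e)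
      (hA₀ ▸ hA.symm ▸ mul_dvd_mul_left _ heA) (hB₀ ▸ hB.symm ▸ mul_dvd_mul_left _ heB) (dvd_mul_right _ _)
    have : e * r = 1 := mul_left_cancel₀ (X_sub_C_ne_zero x) (by rw [mul_one, ← mul_assoc, ← hr])
    exact IsUnit.of_mul_eq_one _ this
  set Θ := A.map (C : F →+* F[X]) + C X * B.map (C : F →+* F[X]) with hΘ
  have hcC : ∀ c : K, algebraMap k E (algebraMap K[X][X] k (C (C c)))
      = algebraMap F[X] E (C (algebraMap K F c)) := fun c => (constHom_algebraMap hc c).symm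
  have hcX : algebraMap k E (algebraMap K[X][X] k (C X)) = algebraMap F[X] E X := by
    rw [hc]; simp [specialize_apply, extendCoeff]
  have hcY : algebraMap k E (algebraMap K[X][X] k X)
      = algebraMap F[X] E (C g) + algebraMap F[X] E X * algebraMap F[X] E (C y) := by
    rw [hc, ← map_mul, ← map_add]; simp [specialize_apply, extendCoeff, genericMember]
  let κ : K →+* k := (algebraMap K[X][X] k).comp (C.comp C)
  -- `x` is a zero of `G + λ Y - τ H`, where `τ` stands for `g + λ y`
  let p : k[X] := G.map κ + C (algebraMap K[X][X] k (C X)) * Y.map κ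
    - C (algebraMap K[X][X] k X) * H.map κ
  have hκ : (algebraMap k E).comp κ = ((algebraMap F[X] E).comp C).comp (algebraMap K F) :=
    RingHom.ext hcC
  have hp : p.map (algebraMap k E)
      = (X - C (constHom F E x)) * Θ.map (algebraMap F[X] E) := by
    have h1 : (X - C (constHom F E x)) * Θ.map (algebraMap F[X] E)
        = A₀.map (constHom F E) + C (algebraMap F[X] E X) * B₀.map (constHom F E) := by
      rw [hA, hB, hΘ]
      simp only [Polynomial.map_add, Polynomial.map_mul, Polynomial.map_sub, Polynomial.map_map,
        map_X, map_C, constHom]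
      ring
    rw [h1, hA₀, hB₀]
    simp only [p, Polynomial.map_add, Polynomial.map_mul, Polynomial.map_sub, Polynomial.map_map,
      map_C, hκ, hcX, hcY, constHom, RingHom.comp_apply, C_add, C_mul]
    ring
  have hΘirr := natDegree_eq_zero_or_irreducible_map (E := E) hAB hB0
  have hinjE : Function.Injective (algebraMap F[X] E) := IsFractionRing.injective F[X] E
  have hΘ0 : Θ.map (algebraMap F[X] E) ≠ 0 := by
    rw [Ne, Polynomial.map_eq_zero_iff hinjE]
    intro h
    have h2 : C A + X * C B = (0 : F[X][X]) := by
      have := congrArg (Bivariate.swap (R := F)) h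
      rw [hΘ, map_add, map_mul, map_zero, Bivariate.swap_map_C, Bivariate.swap_map_C,
        Bivariate.swap_X] at this
      exact this
    have := congrArg (fun q => q.coeff 1) h2
    exact hB0 (by simpa [coeff_C] using this)
  have hp0 : p ≠ 0 := by
    intro h
    rw [h, Polynomial.map_zero] at hp
    exact mul_ne_zero (X_sub_C_ne_zero _) hΘ0 hp.symm
  refine eq_bot_or_eq_top_of_irreducible (x := constHom F E x) ?_ hp0 hp ?_
  · rw [eq_top_iff]
    intro z _
    set N := IntermediateField.adjoin k {constHom F E x}
    have hxN : constHom F E x ∈ N := IntermediateField.mem_adjoin_simple_self k _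
    have hpol : ∀ a : K[X], constHom F E (aeval x a) ∈ N := fun a => by
      rw [aeval_eq_sum_range, map_sum]
      refine sum_mem fun i _ => ?_
      rw [Algebra.smul_def, map_mul, map_pow]
      refine mul_mem ?_ (pow_mem hxN i)
      rw [constHom_algebraMap hc]
      exact N.algebraMap_mem _
    have hF : ∀ f : F, constHom F E f ∈ N := fun f => by
      obtain ⟨a, b, hb, h⟩ := hx f
      have hb' : aeval x b ≠ 0 := fun h0 =>
        hb (transcendental_iff_injective.1 hxt (by simpa using h0))
      rw [eq_div_of_mul_eq hb' h, map_div₀]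
      exact div_mem (hpol a) (hpol b)
    have hFX : ∀ a : F[X], algebraMap F[X] E a ∈ N := fun a => by
      rw [a.as_sum_range_C_mul_X_pow, map_sum]
      refine sum_mem fun i _ => ?_
      rw [map_mul, map_pow, ← hcX]
      exact mul_mem (hF _) (pow_mem (N.algebraMap_mem _) i)
    obtain ⟨a, b, -, rfl⟩ := IsFractionRing.div_surjective (A := F[X]) z
    exact div_mem (hFX a) (hFX b)
  · refine hΘirr.imp (fun h => ?_) id
    rw [natDegree_map_eq_of_injective hinjE]
    exact h

/-! ### The bound for `dim L(D)` -/

theorem Divisor.degree_sub_single (D : Divisor K F) (Q : Place K F) :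
    (D - Finsupp.single Q 1 : Divisor K F).degree = D.degree - 1 := by
  classical
  rw [Divisor.degree, Finsupp.sum_sub_index fun _ _ _ => rfl, Finsupp.sum_single_index rfl]
  rfl

theorem eq_neg_of_notMem_riemannRoch_sub_single {D : Divisor K F} {Q : Place K F} {f : F}
    (hf : f ∈ riemannRoch D) (hf' : f ∉ riemannRoch (D - Finsupp.single Q 1)) :
    Q.v f = ((-D Q : ℤ) : WithTop ℤ) := by
  classical
  refine le_antisymm ?_ (hf Q)
  by_contra hlt
  refine hf' fun Q' => ?_
  by_cases hQ : Q' = Q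
  · subst hQ
    have := not_le.1 hlt
    generalize Q'.v f = m at this ⊢
    cases m with
    | top => exact le_top
    | coe m =>
      simp only [Finsupp.coe_sub, Pi.sub_apply, Finsupp.single_eq_same]
      norm_cast at this ⊢
      omega
  · simpa [Finsupp.single_apply, Ne.symm hQ] using hf Q'

/-- A general element `g` of `S` has all the poles prescribed by `D` and generates `F` together
with `y`: as `F / K(y)` is a simple extension, only finitely many proper subspaces of `S` have to
be avoided. -/
theorem exists_general_element [IsAlgClosed K] (hF : IsFunctionField K F) {x : F}
    (hxtop : IntermediateField.adjoin K {x} = ⊤)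
    {S : Submodule K F} (hS : IntermediateField.adjoin K (S : Set F) = ⊤)
    {D : Divisor K F} (hD : IsLeastDegreeDivisor S D)
    {y : F} (hyS : y ∈ S) (hyt : Transcendental K y) :
    ∃ g ∈ S, g ∉ Submodule.span K {(1 : F)} ∧
      (∀ Q : Place K F, D Q ≠ 0 → Q.v g = ((-D Q : ℤ) : WithTop ℤ)) ∧
      ∀ M : IntermediateField K F, g ∈ M → y ∈ M → M = ⊤ := by
  have halg := hF.isAlgebraic hyt
  have hfin : Finite (IntermediateField (IntermediateField.adjoin K {y}) F) :=
    Field.finite_intermediateField_of_exists_primitive_element _ _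
      ⟨x, IntermediateField.adjoin_eq_top_of_adjoin_eq_top K hxtop⟩
  let ι := {M : IntermediateField (IntermediateField.adjoin K {y}) F // M ≠ ⊤} ⊕ D.support ⊕ Unit
  let p : ι → Subspace K S := Sum.elim
    (fun M => (Subalgebra.toSubmodule (M.1.restrictScalars K).toSubalgebra).comap S.subtype)
    (Sum.elim (fun Q => (riemannRoch (D - Finsupp.single Q.1 1)).comap S.subtype)
      fun _ => (Submodule.span K {(1 : F)}).comap S.subtype)
  have hcover : ⋃ i, (p i : Set S) ≠ Set.univ := by
    intro hcov
    obtain ⟨i, hi⟩ := Subspace.exists_eq_top_of_iUnion_eq_univ hcov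
    rcases i with ⟨M, hM⟩ | ⟨Q, hQ⟩ | _
    · have hle : (S : Set F) ⊆ M.restrictScalars K := fun s hs => by
        have : (⟨s, hs⟩ : S) ∈ p (Sum.inl ⟨M, hM⟩) := hi ▸ Submodule.mem_top
        exact this
      refine hM (eq_top_iff.2 fun z _ => ?_)
      have : z ∈ IntermediateField.adjoin K (S : Set F) := hS ▸ IntermediateField.mem_top
      exact IntermediateField.adjoin_le_iff.2 hle this
    · have hle : S ≤ riemannRoch (D - Finsupp.single Q 1) := fun s hs => by
        have : (⟨s, hs⟩ : S) ∈ p (Sum.inr (Sum.inl ⟨Q, hQ⟩)) := hi ▸ Submodule.mem_top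
        exact this
      have := hD.2 _ hle
      rw [Divisor.degree_sub_single] at this
      omega
    · have : (⟨y, hyS⟩ : S) ∈ p (Sum.inr (Sum.inr ())) := hi ▸ Submodule.mem_top
      obtain ⟨c, hc⟩ := Submodule.mem_span_singleton.1 this
      refine hyt ?_
      have hy : algebraMap K F c = y := by rw [Algebra.algebraMap_eq_smul_one]; exact hc
      exact hy ▸ isAlgebraic_algebraMap c
  obtain ⟨⟨g, hgS⟩, hg⟩ := (Set.ne_univ_iff_exists_notMem _).1 hcover
  simp only [Set.mem_iUnion, not_exists] at hg
  refine ⟨g, hgS, fun h => hg (Sum.inr (Sum.inr ())) h, fun Q hQ => ?_, fun M hgM hyM => ?_⟩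
  · exact eq_neg_of_notMem_riemannRoch_sub_single (hD.1 hgS)
      fun h => hg (Sum.inr (Sum.inl ⟨Q, Finsupp.mem_support_iff.2 hQ⟩)) h
  · have hle : IntermediateField.adjoin K {y} ≤ M :=
      IntermediateField.adjoin_le_iff.2 (Set.singleton_subset_iff.2 hyM)
    by_contra hM
    refine hg (Sum.inl ⟨IntermediateField.extendScalars hle, fun htop => hM ?_⟩) hgM
    refine eq_top_iff.2 fun z _ => ?_
    have : z ∈ IntermediateField.extendScalars hle := htop ▸ IntermediateField.mem_top
    exact this

/-- Passing from `V ⊆ L(D)` over `K` to its span over `k = K(λ, g + λ y)` lowers the dimension by at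
most one if `V` contains `g`. -/
theorem finrank_le_finrank_constSpan_add_one [IsAlgClosed K] (hgen : HasGenus K F 0)
    {k E : Type*} [Field k] [Field E] [Algebra k E] [Algebra K[X][X] k]
    [IsFractionRing K[X][X] k] [Algebra F[X] E] [IsFractionRing F[X] E] {g y : F}
    [FiniteDimensional k E]
    (hc : ∀ c : K[X][X], algebraMap k E (algebraMap K[X][X] k c)
      = algebraMap F[X] E (specialize K g y c))
    {D : Divisor K F} (h1 : (1 : F) ∈ riemannRoch D) (hy : y ∈ riemannRoch D)
    (hgD : ∀ Q : Place K F, D Q ≠ 0 → Q.v g = ((-D Q : ℤ) : WithTop ℤ)) (hg0 : g ≠ 0)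
    {V : Submodule K F} (hV : V ≤ riemannRoch D) (hgV : g ∈ V) :
    FiniteDimensional K V ∧ finrank K V ≤ finrank k (constSpan k E (V : Set F)) + 1 := by
  have hg0' : (⟨g, hgV⟩ : V) ≠ 0 := fun h => hg0 (congrArg Subtype.val h)
  obtain ⟨W, hW⟩ := Submodule.exists_isCompl (Submodule.span K {(⟨g, hgV⟩ : V)})
  have hgW : g ∉ W.map V.subtype := by
    rintro ⟨w, hw, hwg⟩
    have hw' : w = ⟨g, hgV⟩ := Subtype.ext hwg
    exact hg0' (Submodule.disjoint_def.1 hW.disjoint _ (Submodule.mem_span_singleton_self _)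
      (hw' ▸ hw))
  let b := Basis.ofVectorSpace K W
  have hb : LinearIndependent K fun i => ((b i : V) : F) :=
    (b.linearIndependent.map' W.subtype W.ker_subtype).map' V.subtype V.ker_subtype
  have hind := linearIndependent_constHom (E := E) hgen hc h1 (hV hgV) hy hgD
    (W := W.map V.subtype) ((Submodule.map_subtype_le V W).trans hV) hgW hb
    fun i => ⟨b i, (b i).2, rfl⟩
  have hmem : ∀ i, constHom F E ((b i : V) : F) ∈ constSpan k E (V : Set F) := fun i =>
    Submodule.subset_span ⟨_, (b i : V).2, rfl⟩
  have hind' : LinearIndependent k fun i =>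
      (⟨constHom F E ((b i : V) : F), hmem i⟩ : constSpan k E (V : Set F)) :=
    LinearIndependent.of_comp (constSpan k E (V : Set F)).subtype hind
  have : Finite (Basis.ofVectorSpaceIndex K W) := hind'.finite
  have := Fintype.ofFinite (Basis.ofVectorSpaceIndex K W)
  have hWfin : FiniteDimensional K W := Module.Finite.of_basis b
  have hVfin : FiniteDimensional K V := by
    have : FiniteDimensional K (⊤ : Submodule K V) := hW.sup_eq_top ▸ inferInstance
    exact Module.Finite.equiv Submodule.topEquiv
  refine ⟨hVfin, ?_⟩
  have e1 := Submodule.finrank_add_eq_of_isCompl hW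
  have e2 := finrank_span_singleton (K := K) hg0'
  have e3 := hind'.fintype_card_le_finrank
  have e4 := finrank_eq_card_basis b
  omega

theorem constSpan_mul_constSpan_le {k E : Type*} [Field k] [Field E] [Algebra k E]
    [Algebra F[X] E] (V W : Submodule K F) :
    constSpan k E (V : Set F) * constSpan k E (W : Set F)
      ≤ constSpan k E ((V * W : Submodule K F) : Set F) := by
  rw [constSpan, constSpan, Submodule.span_mul_span, Submodule.span_le]
  rintro _ ⟨_, ⟨v, hv, rfl⟩, _, ⟨w, hw, rfl⟩, rfl⟩
  exact Submodule.subset_span ⟨v * w, Submodule.mul_mem_mul hv hw, map_mul _ _ _⟩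

/-- The `3k - 4` theorem for spaces of rational functions: a space `S` with
`dim S² ≤ 3 dim S - 4` lies in a Riemann-Roch space of dimension at most
`dim S² - dim S + 1`. -/
theorem finrank_riemannRoch_add_finrank_le [IsAlgClosed K] (hF : IsFunctionField K F)
    (hgen : HasGenus K F 0) (P : Place K F) {S : Submodule K F} [FiniteDimensional K S]
    (h1 : (1 : F) ∈ S) (hS : IntermediateField.adjoin K (S : Set F) = ⊤)
    {D : Divisor K F} (hD : IsLeastDegreeDivisor S D)
    (hSS : finrank K (S * S : Submodule K F) + 4 ≤ 3 * finrank K S) :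
    FiniteDimensional K (riemannRoch D) ∧
      finrank K (riemannRoch D) + finrank K S ≤ finrank K (S * S : Submodule K F) + 1 := by
  obtain ⟨x, hxt, hx⟩ := exists_rational_generator hF hgen P
  have hxtop : IntermediateField.adjoin K {x} = ⊤ := by
    refine eq_top_iff.2 fun f _ => ?_
    obtain ⟨a, b, hb, h⟩ := hx f
    have hb' : aeval x b ≠ 0 := fun h0 =>
      hb (transcendental_iff_injective.1 hxt (by simpa using h0))
    exact (IntermediateField.mem_adjoin_simple_iff K f).2 ⟨a, b, eq_div_of_mul_eq hb' h⟩
  obtain ⟨y, hyS, hyt⟩ : ∃ y ∈ S, Transcendental K y := by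
    by_contra! hall
    have hle : IntermediateField.adjoin K (S : Set F) ≤ ⊥ :=
      IntermediateField.adjoin_le_iff.2 fun s hs => by
        obtain ⟨c, hc⟩ := exists_algebraMap_eq_of_isAlgebraic (not_not.1 (hall s hs))
        exact IntermediateField.mem_bot.2 ⟨c, hc⟩
    have hxbot : x ∈ (⊥ : IntermediateField K F) := hle (hS ▸ IntermediateField.mem_top)
    obtain ⟨c, rfl⟩ := IntermediateField.mem_bot.1 hxbot
    exact hxt (isAlgebraic_algebraMap c)
  obtain ⟨g, hgS, hg1, hgD, hgM⟩ := exists_general_element hF hxtop hS hD hyS hyt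
  have hg0 : g ≠ 0 := fun h => hg1 (h ▸ Submodule.zero_mem _)
  let E := FractionRing F[X]
  let k := FractionRing K[X][X]
  have hinj : Function.Injective ((algebraMap F[X] E).comp (specialize K g y)) := by
    rw [injective_iff_map_eq_zero]
    intro c hc
    have hc0 : specialize K g y c = 0 := IsFractionRing.injective F[X] E (by simpa using hc)
    exact eq_zero_of_sum_specialize_eq_zero hgen (hD.1 h1) (hD.1 hgS) (hD.1 hyS) hgD
      (W := Submodule.span K {1}) ((Submodule.span_singleton_le_iff_mem _ _).2 (hD.1 h1)) hg1
      (w := fun _ : Unit => (1 : F)) (LinearIndependent.of_subsingleton () one_ne_zero)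
      (fun _ => Submodule.mem_span_singleton_self _) (s := Finset.univ) (c := fun _ => c)
      (by simp [hc0]) () (Finset.mem_univ _)
  let : Algebra k E := (IsFractionRing.lift hinj).toAlgebra
  have hc : ∀ c : K[X][X], algebraMap k E (algebraMap K[X][X] k c)
      = algebraMap F[X] E (specialize K g y c) := fun c => IsFractionRing.lift_algebraMap hinj c
  obtain ⟨hfin, hprim⟩ := eq_bot_or_eq_top_of_specialize hc hxt hx hgM
    fun c h => hyt (h ▸ isAlgebraic_algebraMap c)
  obtain ⟨hLfin, hL⟩ := finrank_le_finrank_constSpan_add_one hgen hc (hD.1 h1) (hD.1 hyS) hgD hg0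
    le_rfl (hD.1 hgS)
  obtain ⟨-, hSk⟩ := finrank_le_finrank_constSpan_add_one hgen hc (hD.1 h1) (hD.1 hyS) hgD hg0
    hD.1 hgS
  have := finiteDimensional_mul S S
  have hmul := finrank_add_finrank_constSpan_le hc S (S * S)
    (fun s hs => by simpa using Submodule.mul_mem_mul h1 hs)
    (fun s hs => Submodule.mul_mem_mul hgS hs) (fun s hs => Submodule.mul_mem_mul hyS hs)
  -- if `kS · kS ≠ E`, then Cauchy-Davenport would give `dim S² ≥ 3 dim S - 3`
  have hle := constSpan_mul_constSpan_le (k := k) (E := E) S S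
  have hne : constSpan k E (S : Set F) ≠ ⊥ := by
    refine (Submodule.ne_bot_iff _).2 ⟨1, Submodule.subset_span ⟨1, h1, map_one _⟩, one_ne_zero⟩
  refine ⟨hLfin, ?_⟩
  rcases mul_eq_top_or_finrank_add_le hprim _ _ hne hne with h | h
  · rw [h, top_le_iff] at hle
    rw [hle, finrank_top] at hmul
    have := Submodule.finrank_le (constSpan k E (riemannRoch D : Set F))
    omega
  · have := Submodule.finrank_mono hle
    omega

end FreimanFF

theorem theorem1p7 {K F : Type*} [Field K] [IsAlgClosed K] [Field F] [Algebra K F]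
    -- `F` is a function field of genus `0` over `K`
    (hF : FreimanFF.IsFunctionField K F) (hg : FreimanFF.HasGenus K F 0)
    -- `S` is an `n`-dimensional subspace that contains `K`, and `F = K(S)`
    (S : Submodule K F) (h1 : (1 : F) ∈ S)
    (hS : IntermediateField.adjoin K (S : Set F) = ⊤)
    -- the natural filtration `S_1 ⊂ … ⊂ S_n = S` at a place `P`, given by a filtered basis
    (P : FreimanFF.Place K F) (n : ℕ) (e : Fin n → F) (he : FreimanFF.IsFilteredBasis P S e)
    -- `γ ≤ n - 3`
    (hγ : FreimanFF.combGenus S ≤ (n : ℤ) - 3)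
    -- `D_i` is the divisor of least degree with `S_i ⊆ L(D_i)`
    (D : ℕ → FreimanFF.Divisor K F)
    (hD : ∀ i ∈ Set.Icc 1 n,
      FreimanFF.IsLeastDegreeDivisor (FreimanFF.filtration (K := K) e i) (D i))
    -- `Δ` is the largest growth of degree in the sequence `D_1, …, D_n`
    (Δ : ℕ)
    (hΔ : IsGreatest ((fun i : ℕ => (D i).degree - (D (i - 1)).degree) '' Set.Icc 2 n) (Δ : ℤ))
    -- `γ_3 = 0`, and `γ_Δ` is a member of the sequence `γ_1, …, γ_n` and equals `0`
    (hγ3 : FreimanFF.combGenus (FreimanFF.filtration (K := K) e 3) = 0)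
    (hΔn : Δ ≤ n)
    (hγΔ : FreimanFF.combGenus (FreimanFF.filtration (K := K) e Δ) = 0) :
    S ≤ FreimanFF.riemannRoch (D n) ∧
      FiniteDimensional K (FreimanFF.riemannRoch (D n)) ∧
      (Module.finrank K (FreimanFF.riemannRoch (D n)) : ℤ) ≤ n + FreimanFF.combGenus S := by
  have hfin : FiniteDimensional K S := he.span_eq ▸ FiniteDimensional.span_of_finite K
    (Set.finite_range e)
  have hn : Module.finrank K S = n := by
    rw [← he.span_eq, finrank_span_eq_card he.linearIndependent, Fintype.card_fin]
  have hn1 : 1 ≤ n := by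
    rw [← hn]
    exact Submodule.one_le_finrank_iff.2 (Submodule.ne_bot_iff _ |>.2 ⟨1, h1, one_ne_zero⟩)
  have hSn : FreimanFF.filtration (K := K) e n = S := by
    rw [← he.span_eq, FreimanFF.filtration]
    congr 1
    simp
  have hDn := hD n ⟨hn1, le_rfl⟩
  rw [hSn] at hDn
  simp only [FreimanFF.combGenus, hn] at hγ ⊢
  obtain ⟨hL, hle⟩ := FreimanFF.finrank_riemannRoch_add_finrank_le hF hg P h1 hS hDn (by omega)
  exact ⟨hDn.1, hL, by omega⟩
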